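/- There is an absolute constant $c$ such that the following holds for all integers $\Delta,k\ge 0$ and $n\ge 1$. Let $V$ be a known set of $n$ vertices, and let $\mathcal G$ be the class of connected graphs on $V$ with maximum degree at most $\Delta$ and treelength at most $k$, where a connected graph $G$ has treelength at most $k$ if it has a tree decomposition in which any two vertices that share a bag are at distance at most $k$ in $G$. A distance query asks for a pair $u,v\in V$ and returns the shortest-path distance $d_G(u,v)$ in the hidden graph $G$. A randomised adaptive algorithm is a probability distribution over (always terminating) decision trees whose inner nodes are distance queries, branching on the answer, and whose leaves output a graph on $V$. Then there is a randomised adaptive algorithm, depending only on $V$, $\Delta$ and $k$, that reconstructs every $G\in\mathcal G$ with certainty (it outputs $G$, and the answers it receives are not compatible with any other graph of $\mathcal G$), and whose expected number of distance queries on every $G\in\mathcal G$ is at most $$\Delta^{ck}\, n\,(\log_2 n)^2 ,$$ with the convention $0^0=1$. In particular, the expected number of queries is $O_{k,\Delta}(n\log^2 n)$. -/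

import Mathlib

open scoped ENNReal

universe u

/-- A tree decomposition of `G`: a finite tree `T` on the index type `ι` with a bag of vertices
at each node, such that for every vertex the nodes whose bags contain it form a non-empty subtree
(`Connected` includes non-emptiness), and every edge is contained in some bag. -/
structure TreeDecomposition {V : Type u} (G : SimpleGraph V) (ι : Type) [Finite ι] where
  /-- The decomposition tree. -/
  T : SimpleGraph ι
  /-- The bags. -/
  bag : ι → Set V
  isTree : T.IsTree
  connected_support : ∀ v : V, (T.induce {t | v ∈ bag t}).Connected
  exists_bag_of_adj : ∀ u v : V, G.Adj u v → ∃ t, u ∈ bag t ∧ v ∈ bag t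

/-- `G` (a connected graph) has treelength at most `k`: it admits a tree decomposition in which
any two vertices sharing a bag are at distance at most `k` in the whole graph `G`. -/
def TreelengthAtMost {V : Type u} (G : SimpleGraph V) (k : ℕ) : Prop :=
  ∃ (ι : Type) (_ : Finite ι) (D : TreeDecomposition G ι),
    ∀ t : ι, ∀ u ∈ D.bag t, ∀ v ∈ D.bag t, G.dist u v ≤ k

open scoped Classical in
/-- The connected graphs on the vertex set `V` with maximum degree at most `Δ` and treelength
at most `k`. -/
def boundedTreelengthClass (V : Type u) [Fintype V] (Δ k : ℕ) : Set (SimpleGraph V) :=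
  {G | G.Connected ∧ G.maxDegree ≤ Δ ∧ TreelengthAtMost G k}

/-- A deterministic adaptive distance query algorithm on a known vertex set `V`, as a decision
tree: either stop and output a graph, or query a pair of vertices and continue depending on the
distance returned. Along every sequence of answers the tree stops after finitely many queries. -/
inductive QueryTree (V : Type u) : Type u
  | output (H : SimpleGraph V) : QueryTree V
  | query (u v : V) (next : ℕ → QueryTree V) : QueryTree V

namespace QueryTree

variable {V : Type u}

/-- The list of queries (with repetitions) asked when the hidden graph is `G`. -/
noncomputable def asked (G : SimpleGraph V) : QueryTree V → List (V × V)
  | output _ => []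
  | query u v next => (u, v) :: (next (G.dist u v)).asked G

/-- The graph that is output when the hidden graph is `G`. -/
noncomputable def result (G : SimpleGraph V) : QueryTree V → SimpleGraph V
  | output H => H
  | query u v next => (next (G.dist u v)).result G

/-- `A` reconstructs the graphs of a class `𝒢` of connected graphs: on every hidden graph `G` of
the class it outputs `G`, and the distances obtained from the queries are not compatible with any
other graph of the class. -/
def Reconstructs (A : QueryTree V) (𝒢 : Set (SimpleGraph V)) : Prop :=
  ∀ G ∈ 𝒢, A.result G = G ∧
    ∀ H ∈ 𝒢, (∀ q ∈ A.asked G, H.dist q.1 q.2 = G.dist q.1 q.2) → H = G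

end QueryTree

/-- A randomised adaptive distance query algorithm: a probability distribution over decision
trees. -/
abbrev RandomisedQueryAlgorithm (V : Type u) : Type u := PMF (QueryTree V)

namespace RandomisedQueryAlgorithm

variable {V : Type u}

/-- The algorithm always reconstructs: every decision tree that is drawn with positive probability
reconstructs the class. -/
def Reconstructs (A : RandomisedQueryAlgorithm V) (𝒢 : Set (SimpleGraph V)) : Prop :=
  ∀ D ∈ PMF.support A, D.Reconstructs 𝒢

/-- The expected number of queries, over the randomness of the algorithm, when the hidden graph
is `G`. -/
noncomputable def expectedQueries (A : RandomisedQueryAlgorithm V) (G : SimpleGraph V) : ℝ≥0∞ :=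
  ∑' D : QueryTree V, A D * ((D.asked G).length : ℝ≥0∞)

end RandomisedQueryAlgorithm

/-!
The reconstruction is deterministic and uses `O(n log n)` queries for fixed `Δ` and `k`; the
randomised algorithm is the point mass at one decision tree.

Algorithms are handled through the game `Learn`, played on the set of graphs still compatible with
the answers: since a decision tree may use everything that these graphs have in common, the
algorithm only has to be described as a choice of queries, and `Learn.exists_queryTree` turns a
strategy into a tree. That no other graph of the class is compatible with the answers comes for
free, because such a graph would be led to the same leaf.

The distances to a root `r` are queried first. The vertices are then inserted in order of their
distance to `r`, so that the set `K` of inserted vertices contains everything nearer to the root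
than the next vertex `v`; the graph induced on `K` is known. To insert `v`:

* A parent of `v`, that is a neighbour nearer to the root, is found by binary search
  (`learn_parent`). Any bag of a tree decomposition has at most `(Δ + 1) ^ k` vertices, and
  some bag halves any given set of vertices (`TreeDecomposition.exists_balanced_bag`). The
  distances from `v` to such a bag show whether the geodesics from `v` towards the root meet it,
  and so in which component to go on.
* All other known neighbours of `v` lie at bounded distance from the parent inside `K`
  (`exists_short_walk_in_known`), because intersection graphs of subtrees of a tree have no induced
  4-cycle (`subtrees_no_induced_four_cycle`). So it is enough to query `v` against a ball of the
  known graph, of size at most `(Δ + 1) ^ (5 * k + 4)`.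

The strategy needs no tree decomposition of the hidden graph: separators and balls are taken from
an arbitrary reference graph among the remaining candidates, which agrees with the hidden one on
`K`.
-/

/-! ### Connected sets of vertices -/

/-- The set `X` induces a preconnected subgraph of `G`, phrased with walks of `G` itself. -/
def ConnectedOn {V : Type*} (G : SimpleGraph V) (X : Set V) : Prop :=
  ∀ x ∈ X, ∀ y ∈ X, ∃ p : G.Walk x y, ∀ z ∈ p.support, z ∈ X

theorem connectedOn_of_center {V : Type*} {G : SimpleGraph V} {X : Set V} (c : V)
    (h : ∀ x ∈ X, ∃ p : G.Walk c x, ∀ z ∈ p.support, z ∈ X) : ConnectedOn G X := by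
  intro x hx y hy
  obtain ⟨p, hp⟩ := h x hx
  obtain ⟨q, hq⟩ := h y hy
  refine ⟨p.reverse.append q, fun z hz => ?_⟩
  rw [SimpleGraph.Walk.mem_support_append_iff, SimpleGraph.Walk.support_reverse,
    List.mem_reverse] at hz
  exact hz.elim (hp z) (hq z)

theorem connectedOn_singleton {V : Type*} (G : SimpleGraph V) (x : V) : ConnectedOn G {x} :=
  connectedOn_of_center x fun y hy => by
    obtain rfl : y = x := hy
    exact ⟨.nil, by simp⟩

theorem connectedOn_support {V : Type*} {G : SimpleGraph V} {x y : V} (p : G.Walk x y) :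
    ConnectedOn G {z | z ∈ p.support} := by
  classical
  exact connectedOn_of_center x fun z hz =>
    ⟨p.takeUntil z hz, fun _ hw => p.support_takeUntil_subset_support hz hw⟩

theorem connectedOn_of_induce_connected {V : Type*} {G : SimpleGraph V} {X : Set V}
    (h : (G.induce X).Connected) : ConnectedOn G X := by
  intro x hx y hy
  obtain ⟨p⟩ := h.preconnected ⟨x, hx⟩ ⟨y, hy⟩
  let φ : G.induce X →g G := ⟨Subtype.val, fun hab => hab⟩
  refine ⟨p.map φ, fun z hz => ?_⟩
  rw [SimpleGraph.Walk.support_map, List.mem_map] at hz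
  obtain ⟨w, -, rfl⟩ := hz
  exact w.2

/-! ### Subtrees of a tree -/

/-- The nodes of `T` on the side of `t` when the edge between `s` and `t` is removed. -/
def edgeSide {ι : Type*} (T : SimpleGraph ι) (s t : ι) : Set ι :=
  {x | (T.deleteEdges {s(s, t)}).Reachable t x}

theorem reachable_deleteEdges_of_walk {ι : Type*} {T : SimpleGraph ι} {s t x y : ι}
    (p : T.Walk x y) (h : s ∉ p.support) : (T.deleteEdges {s(s, t)}).Reachable x y := by
  refine ⟨p.toDeleteEdge s(s, t) fun he => h ?_⟩
  exact p.fst_mem_support_of_mem_edges he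

theorem edgeSide_swap {ι : Type*} (T : SimpleGraph ι) (s t x : ι) :
    x ∈ edgeSide T t s ↔ (T.deleteEdges {s(s, t)}).Reachable s x := by
  rw [edgeSide, Sym2.eq_swap]; rfl

theorem disjoint_edgeSide {ι : Type*} {T : SimpleGraph ι} (hT : T.IsTree) {s t x : ι}
    (hst : T.Adj s t) (h1 : x ∈ edgeSide T s t) (h2 : x ∈ edgeSide T t s) : False := by
  rw [edgeSide_swap] at h2
  have := SimpleGraph.isAcyclic_iff_forall_isBridge.1 hT.isAcyclic
    (e := s(s, t)) hst
  rw [SimpleGraph.isBridge_iff] at this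
  exact this (h2.trans (SimpleGraph.Reachable.symm h1))

theorem ConnectedOn.subset_edgeSide {ι : Type*} {T : SimpleGraph ι} {s t : ι} {X : Set ι}
    (hX : ConnectedOn T X) (hs : s ∉ X) {x : ι} (hx : x ∈ X) (hxt : x ∈ edgeSide T s t) :
    X ⊆ edgeSide T s t := by
  intro y hy
  obtain ⟨p, hp⟩ := hX x hx y hy
  exact SimpleGraph.Reachable.trans hxt
    (reachable_deleteEdges_of_walk p fun h => hs (hp _ h))

/-- The last vertex of a walk in a set `A`, if the walk meets `A` and ends outside. -/
theorem exists_last_exit {ι : Type*} {T : SimpleGraph ι} {A : Set ι} {x y : ι} (p : T.Walk x y)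
    (hm : ∃ z ∈ p.support, z ∈ A) (hy : y ∉ A) :
    ∃ s t, s ∈ A ∧ T.Adj s t ∧ ∃ q : T.Walk t y, ∀ z ∈ q.support, z ∉ A := by
  induction p with
  | nil =>
    obtain ⟨z, hz, hzA⟩ := hm
    simp at hz; subst hz; exact absurd hzA hy
  | @cons a b c h q ih =>
    by_cases hq : ∃ z ∈ q.support, z ∈ A
    · exact ih hq hy
    · push Not at hq
      obtain ⟨z, hz, hzA⟩ := hm
      rw [SimpleGraph.Walk.support_cons, List.mem_cons] at hz
      rcases hz with rfl | hz
      · exact ⟨z, b, hzA, h, q, hq⟩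
      · exact absurd hzA (hq z hz)

/-- Two disjoint subtrees are separated by an edge leaving the first one. -/
theorem exists_separating_edge {ι : Type*} {T : SimpleGraph ι} (hT : T.IsTree) {A C : Set ι}
    (hA : ConnectedOn T A) (hC : ConnectedOn T C) (hAn : A.Nonempty) (hCn : C.Nonempty)
    (hAC : Disjoint A C) :
    ∃ s t, s ∈ A ∧ T.Adj s t ∧ A ⊆ edgeSide T t s ∧ C ⊆ edgeSide T s t := by
  obtain ⟨a, ha⟩ := hAn
  obtain ⟨c, hc⟩ := hCn
  obtain ⟨p⟩ := hT.connected.preconnected a c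
  obtain ⟨s, t, hs, hst, q, hq⟩ :=
    exists_last_exit p ⟨a, p.start_mem_support, ha⟩ (Set.disjoint_right.1 hAC hc)
  refine ⟨s, t, hs, hst, ?_, ?_⟩
  · exact hA.subset_edgeSide (hq t q.start_mem_support) hs (SimpleGraph.Reachable.refl s)
  · exact hC.subset_edgeSide (Set.disjoint_left.1 hAC hs) hc
      (reachable_deleteEdges_of_walk q fun h => hq s h hs)

/-- Four subtrees cannot intersect in the pattern of an induced 4-cycle: intersection graphs of
subtrees are chordal. -/
theorem subtrees_no_induced_four_cycle {ι : Type*} {T : SimpleGraph ι} (hT : T.IsTree)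
    {A B C D : Set ι} (hA : ConnectedOn T A) (hB : ConnectedOn T B) (hC : ConnectedOn T C)
    (hD : ConnectedOn T D) (hAB : (A ∩ B).Nonempty) (hBC : (B ∩ C).Nonempty)
    (hCD : (C ∩ D).Nonempty) (hDA : (D ∩ A).Nonempty) (hAC : Disjoint A C) :
    (B ∩ D).Nonempty := by
  obtain ⟨s, t, -, hst, hAs, hCt⟩ :=
    exists_separating_edge hT hA hC hAB.left hCD.left hAC
  have key : ∀ X : Set ι, ConnectedOn T X → (X ∩ A).Nonempty → (X ∩ C).Nonempty → s ∈ X := by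
    rintro X hX ⟨x, hx, hxA⟩ ⟨y, hy, hyC⟩
    by_contra hs
    exact disjoint_edgeSide hT hst (hX.subset_edgeSide hs hy (hCt hyC) hx) (hAs hxA)
  exact ⟨s, key B hB (Set.inter_comm A B ▸ hAB) hBC, key D hD hDA (Set.inter_comm C D ▸ hCD)⟩

namespace TreeDecomposition

variable {V : Type u} {G : SimpleGraph V} {ι : Type} [Finite ι] (D : TreeDecomposition G ι)

/-- The nodes whose bags meet `C`. -/
def trace (C : Set V) : Set ι := {t | ∃ v ∈ C, v ∈ D.bag t}

theorem exists_mem_bag (v : V) : ∃ t, v ∈ D.bag t := by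
  obtain ⟨t⟩ := (D.connected_support v).nonempty
  exact ⟨t, t.2⟩

theorem trace_inter_nonempty {B C : Set V} {v : V} (hB : v ∈ B) (hC : v ∈ C) :
    (D.trace B ∩ D.trace C).Nonempty := by
  obtain ⟨t, ht⟩ := D.exists_mem_bag v
  exact ⟨t, ⟨v, hB, ht⟩, ⟨v, hC, ht⟩⟩

theorem connectedOn_trace {C : Set V} (hC : ConnectedOn G C) : ConnectedOn D.T (D.trace C) := by
  have single : ∀ v ∈ C, ∀ s t, v ∈ D.bag s → v ∈ D.bag t →
      ∃ p : D.T.Walk s t, ∀ z ∈ p.support, z ∈ D.trace C := by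
    intro v hv s t hs ht
    obtain ⟨p, hp⟩ := connectedOn_of_induce_connected (D.connected_support v) s hs t ht
    exact ⟨p, fun z hz => ⟨v, hv, hp z hz⟩⟩
  have along : ∀ {x y : V} (p : G.Walk x y), (∀ z ∈ p.support, z ∈ C) →
      ∀ s t, x ∈ D.bag s → y ∈ D.bag t →
        ∃ q : D.T.Walk s t, ∀ z ∈ q.support, z ∈ D.trace C := by
    intro x y p
    induction p with
    | nil => exact fun h s t hs ht => single _ (h _ (by simp)) s t hs ht
    | @cons a b c hab p ih =>
      intro h s t hs ht
      obtain ⟨r, har, hbr⟩ := D.exists_bag_of_adj a b hab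
      obtain ⟨q₁, hq₁⟩ := single a (h a (by simp)) s r hs har
      obtain ⟨q₂, hq₂⟩ := ih (fun z hz => h z (by simp [hz])) r t hbr ht
      refine ⟨q₁.append q₂, fun z hz => ?_⟩
      rw [SimpleGraph.Walk.mem_support_append_iff] at hz
      exact hz.elim (hq₁ z) (hq₂ z)
  rintro s ⟨x, hx, hxs⟩ t ⟨y, hy, hyt⟩
  obtain ⟨p, hp⟩ := hC x hx y hy
  exact along p hp s t hxs hyt

/-- Some bag is a balanced separator for `A`. If every bag `t` missed a connected subset of `A`
with more than half of `A`, then such subsets pairwise intersect; among the directed edges of the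
tree pointing towards the trace of such a subset, one whose far side is smallest could be
replaced by a deeper one. -/
theorem exists_balanced_bag (A : Finset V) :
    ∃ t, ∀ X : Finset V, X ⊆ A → (∀ x ∈ X, x ∉ D.bag t) → ConnectedOn G (X : Set V) →
      2 * X.card ≤ A.card := by
  classical
  by_contra! hcon
  choose C hCA hCt hCc hCn using hcon
  have meet : ∀ s t, ∃ v, v ∈ C s ∧ v ∈ C t := by
    intro s t
    by_contra! hdis
    have h1 := Finset.card_union_of_disjoint (Finset.disjoint_left.2 hdis)
    have h2 := Finset.card_le_card (Finset.union_subset (hCA s) (hCA t))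
    have := hCn s; have := hCn t
    omega
  have far : ∀ t, ∃ u, D.T.Adj t u ∧ D.trace (C t) ⊆ edgeSide D.T t u := by
    intro t
    obtain ⟨v, hv, -⟩ := meet t t
    obtain ⟨r, hr⟩ := D.exists_mem_bag v
    obtain ⟨s, u, hs, hsu, -, h⟩ := exists_separating_edge D.isTree
      (connectedOn_singleton D.T t) (D.connectedOn_trace (hCc t)) ⟨t, rfl⟩ ⟨r, v, hv, hr⟩
      (Set.disjoint_singleton_left.2 fun ⟨x, hx, hxt⟩ => hCt t x hx hxt)
    obtain rfl : s = t := hs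
    exact ⟨u, hsu, h⟩
  choose f hadj hside using far
  obtain ⟨t₀⟩ := D.isTree.connected.nonempty
  obtain ⟨s, -, hmin⟩ := Set.exists_min_image (Set.univ : Set ι)
    (fun t => (edgeSide D.T t (f t)).ncard) Set.finite_univ ⟨t₀, trivial⟩
  obtain ⟨v, hv, hv'⟩ := meet s (f s)
  obtain ⟨r, hr⟩ := D.exists_mem_bag v
  have hr₁ : r ∈ edgeSide D.T s (f s) := hside s ⟨v, hv, hr⟩
  have hr₂ : r ∈ edgeSide D.T (f s) (f (f s)) := hside (f s) ⟨v, hv', hr⟩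
  have hne : f (f s) ≠ s := fun h => by
    rw [h] at hr₂
    exact disjoint_edgeSide D.isTree (hadj s) hr₁ hr₂
  -- `s` is joined to `f s` by an edge different from the one removed next
  have hs : s ∈ edgeSide D.T (f (f s)) (f s) := by
    refine SimpleGraph.Adj.reachable ?_
    rw [SimpleGraph.deleteEdges_adj]
    refine ⟨(hadj s).symm, fun h => ?_⟩
    rcases Sym2.eq_iff.1 (Set.mem_singleton_iff.1 h) with ⟨-, h⟩ | ⟨-, h⟩
    · exact (hadj s).ne h
    · exact hne h.symm
  have hconn : ConnectedOn D.T (edgeSide D.T (f s) (f (f s))) := by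
    refine connectedOn_of_center (f (f s)) ?_
    rintro x ⟨p⟩
    refine ⟨p.mapLe (SimpleGraph.deleteEdges_le _), fun z hz => ?_⟩
    rw [SimpleGraph.Walk.support_mapLe_eq_support] at hz
    exact ⟨p.takeUntil z hz⟩
  have hsub : edgeSide D.T (f s) (f (f s)) ⊆ edgeSide D.T s (f s) :=
    hconn.subset_edgeSide (fun h => disjoint_edgeSide D.isTree (hadj (f s)) h hs) hr₂ hr₁
  have hlt : edgeSide D.T (f s) (f (f s)) ⊂ edgeSide D.T s (f s) := by
    refine ⟨hsub, fun h => ?_⟩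
    exact disjoint_edgeSide D.isTree (hadj (f s)) (h (SimpleGraph.Reachable.refl (f s)))
      (SimpleGraph.Reachable.refl (f s))
  exact absurd (hmin (f s) trivial) (not_le.2 (Set.ncard_lt_ncard hlt))

end TreeDecomposition

/-! ### Geodesics and balls -/

theorem exists_adj_closer {V : Type*} {G : SimpleGraph V} (hG : G.Connected) {x v : V}
    (h : x ≠ v) : ∃ y, G.Adj x y ∧ G.dist y v + 1 = G.dist x v := by
  obtain ⟨p, hp⟩ := hG.exists_walk_length_eq_dist x v
  cases p with
  | nil => exact absurd rfl h
  | @cons _ y _ hxy q =>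
    refine ⟨y, hxy, ?_⟩
    have h1 := SimpleGraph.dist_le q
    have h2 := hG.dist_triangle (u := x) (v := y) (w := v)
    have h3 := SimpleGraph.dist_eq_one_iff_adj.2 hxy
    rw [SimpleGraph.Walk.length_cons] at hp
    omega

theorem exists_descending_walk {V : Type*} {G : SimpleGraph V} (hG : G.Connected) (r x : V)
    (m : ℕ) (hm : m ≤ G.dist x r) :
    ∃ y, ∃ p : G.Walk x y, p.length + m = G.dist x r ∧ G.dist y r = m ∧
      ∀ z ∈ p.support, m ≤ G.dist z r ∧ (z = x ∨ G.dist z r < G.dist x r) := by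
  induction hd : G.dist x r - m generalizing x with
  | zero => exact ⟨x, .nil, by simp; omega, by omega, by simp; omega⟩
  | succ d ih =>
    have hne : x ≠ r := by rintro rfl; simp at hd
    obtain ⟨x', hadj, hx'⟩ := exists_adj_closer hG hne
    obtain ⟨y, p, h1, h2, h3⟩ := ih x' (by omega) (by omega)
    refine ⟨y, .cons hadj p, by simp; omega, h2, fun z hz => ?_⟩
    rw [SimpleGraph.Walk.support_cons, List.mem_cons] at hz
    rcases hz with rfl | hz
    · exact ⟨hm, Or.inl rfl⟩
    · obtain ⟨h4, h5⟩ := h3 z hz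
      refine ⟨h4, Or.inr ?_⟩
      rcases h5 with rfl | h5 <;> omega

theorem dist_add_dist_le_length {V : Type*} {G : SimpleGraph V} {x y z : V} (p : G.Walk x y)
    (hz : z ∈ p.support) : G.dist x z + G.dist z y ≤ p.length := by
  classical
  have h := congrArg SimpleGraph.Walk.length (p.take_spec hz)
  rw [SimpleGraph.Walk.length_append] at h
  have h1 := SimpleGraph.dist_le (p.takeUntil z hz)
  have h2 := SimpleGraph.dist_le (p.dropUntil z hz)
  omega

open scoped Classical in
theorem exists_ball_finset {V : Type*} [Fintype V] {G : SimpleGraph V} {Δ : ℕ}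
    (hΔ : G.maxDegree ≤ Δ) (r : ℕ) (x : V) :
    ∃ B : Finset V, B.card ≤ (Δ + 1) ^ r ∧ ∀ y, ∀ p : G.Walk x y, p.length ≤ r → y ∈ B := by
  induction r generalizing x with
  | zero =>
    refine ⟨{x}, by simp, fun y p hp => ?_⟩
    have := SimpleGraph.Walk.eq_of_length_eq_zero (Nat.le_zero.1 hp)
    simp [this]
  | succ r ih =>
    choose B hB hB' using ih
    refine ⟨(insert x (G.neighborFinset x)).biUnion B, ?_, fun y p hp => ?_⟩
    · refine (Finset.card_biUnion_le_card_mul _ _ ((Δ + 1) ^ r) fun a _ => hB a).trans ?_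
      rw [pow_succ, mul_comm]
      refine Nat.mul_le_mul_left _ ((Finset.card_insert_le _ _).trans ?_)
      rw [SimpleGraph.card_neighborFinset_eq_degree]
      exact Nat.add_le_add_right ((G.degree_le_maxDegree x).trans hΔ) 1
    · rw [Finset.mem_biUnion]
      cases p with
      | nil => exact ⟨x, Finset.mem_insert_self _ _, hB' x x .nil (Nat.zero_le _)⟩
      | @cons _ z _ h q =>
        refine ⟨z, Finset.mem_insert_of_mem (by simpa using h), hB' z y q ?_⟩
        rw [SimpleGraph.Walk.length_cons] at hp
        omega

theorem exists_walk_of_agree {V : Type*} {G H : SimpleGraph V} {K : Set V}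
    (h : ∀ u ∈ K, ∀ w ∈ K, G.Adj u w → H.Adj u w) {x y : V} (p : G.Walk x y)
    (hp : ∀ z ∈ p.support, z ∈ K) :
    ∃ q : H.Walk x y, q.length = p.length ∧ q.support = p.support := by
  refine ⟨p.transfer H fun e => ?_, by simp, by simp⟩
  induction e using Sym2.ind with
  | _ a b =>
    intro he
    exact h a (hp a (p.fst_mem_support_of_mem_edges he)) b
      (hp b (p.snd_mem_support_of_mem_edges he)) (p.adj_of_mem_edges he)

/-! ### Neighbours of a vertex in the previous layers -/

/-- In a graph of treelength at most `k`, two neighbours `p`, `w` of `v` in a set `K` containing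
all vertices nearer to the root `r` than `v` are joined by a short walk inside `K`.
Let `L ≥ 2 * k + 2` be the distance from `v` to `r`, `a = L - 1 - k`, `b = a - k - 1`. The ball of
radius `b` about `r`, the two geodesics from `p` and `w` to `r` between the distances `a` and `b`,
and the part at distance at least `a` form a 4-cycle of connected sets. The ball and the part
at distance at least `a` do not share a bag, so the two geodesic segments do, and a geodesic
between these two points of the bag stays too near the root to leave `K`. -/
theorem exists_short_walk_in_known {V : Type u} {G : SimpleGraph V} (hG : G.Connected) {k : ℕ}
    (hk : TreelengthAtMost G k) {r v p w : V} {K : Set V}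
    (hK : ∀ x, G.dist x r < G.dist v r → x ∈ K) (hp : p ∈ K) (hw : w ∈ K)
    (hpv : G.Adj p v) (hwv : G.Adj w v) (hpl : G.dist p r + 1 = G.dist v r)
    (hwl : G.dist w r ≤ G.dist v r) :
    ∃ q : G.Walk p w, q.length ≤ 5 * k + 4 ∧ ∀ z ∈ q.support, z ∈ K := by
  classical
  have hwl' : G.dist v r ≤ G.dist w r + 1 := by
    have h1 := hG.dist_triangle (u := v) (v := w) (w := r)
    have h2 := SimpleGraph.dist_eq_one_iff_adj.2 hwv.symm
    omega
  have inK : ∀ x ∈ K, G.dist x r ≤ G.dist v r → ∀ z,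
      (z = x ∨ G.dist z r < G.dist x r) → z ∈ K := by
    rintro x hx hxl z (rfl | hz)
    · exact hx
    · exact hK z (hz.trans_le hxl)
  rcases Nat.lt_or_ge (G.dist v r) (2 * k + 2) with hL | hL
  · -- near the root: go through the root
    obtain ⟨x, P, hP1, hx, hP2⟩ := exists_descending_walk hG r p 0 (Nat.zero_le _)
    obtain ⟨y, Q, hQ1, hy, hQ2⟩ := exists_descending_walk hG r w 0 (Nat.zero_le _)
    obtain rfl : x = r := hG.dist_eq_zero_iff.1 hx
    obtain rfl : y = x := hG.dist_eq_zero_iff.1 hy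
    refine ⟨P.append Q.reverse, ?_, fun z hz => ?_⟩
    · rw [SimpleGraph.Walk.length_append, SimpleGraph.Walk.length_reverse]
      omega
    · rw [SimpleGraph.Walk.mem_support_append_iff, SimpleGraph.Walk.support_reverse,
        List.mem_reverse] at hz
      rcases hz with hz | hz
      · exact inK p hp (by omega) z (hP2 z hz).2
      · exact inK w hw hwl z (hQ2 z hz).2
  obtain ⟨b, hb⟩ : ∃ b, G.dist v r = b + 2 * k + 2 := ⟨G.dist v r - (2 * k + 2), by omega⟩
  obtain ⟨ι, _, D, hD⟩ := hk
  obtain ⟨x₁, P₁, hP₁, hx₁, hP₁'⟩ := exists_descending_walk hG r p (b + k + 1) (by omega)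
  obtain ⟨y₁, Q₁, hQ₁, hy₁, hQ₁'⟩ := exists_descending_walk hG r w (b + k + 1) (by omega)
  obtain ⟨x₂, P₂, hP₂, hx₂, hP₂'⟩ := exists_descending_walk hG r x₁ b (by omega)
  obtain ⟨y₂, Q₂, hQ₂, hy₂, hQ₂'⟩ := exists_descending_walk hG r y₁ b (by omega)
  have hU : ConnectedOn G {z | G.dist z r ≤ b} := by
    refine connectedOn_of_center r fun z hz => ?_
    have hz : G.dist z r ≤ b := hz
    obtain ⟨y, R, -, hy, hR⟩ := exists_descending_walk hG r z 0 (Nat.zero_le _)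
    obtain rfl : y = r := hG.dist_eq_zero_iff.1 hy
    refine ⟨R.reverse, fun t ht => ?_⟩
    rw [SimpleGraph.Walk.support_reverse, List.mem_reverse] at ht
    show G.dist t y ≤ b
    rcases (hR t ht).2 with rfl | h <;> omega
  let W : G.Walk x₁ y₁ := P₁.reverse.append (.cons hpv (.cons hwv.symm Q₁))
  have hWsupp : ∀ z, z ∈ W.support ↔ z ∈ P₁.support ∨ z = v ∨ z ∈ Q₁.support := by
    intro z
    simp only [W, SimpleGraph.Walk.mem_support_append_iff, SimpleGraph.Walk.support_reverse,
      List.mem_reverse, SimpleGraph.Walk.support_cons, List.mem_cons]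
    constructor
    · rintro (h | rfl | rfl | h)
      · exact Or.inl h
      · exact Or.inl P₁.start_mem_support
      · exact Or.inr (Or.inl rfl)
      · exact Or.inr (Or.inr h)
    · rintro (h | rfl | h)
      · exact Or.inl h
      · exact Or.inr (Or.inr (Or.inl rfl))
      · exact Or.inr (Or.inr (Or.inr h))
  have hWlow : ∀ z ∈ W.support, b + k + 1 ≤ G.dist z r := by
    intro z hz
    rcases (hWsupp z).1 hz with h | rfl | h
    · exact (hP₁' z h).1
    · omega
    · exact (hQ₁' z h).1
  have hdisj : Disjoint (D.trace {z | G.dist z r ≤ b}) (D.trace {z | z ∈ W.support}) := by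
    rw [Set.disjoint_left]
    rintro t ⟨u, hu, hut⟩ ⟨z, hz, hzt⟩
    have h1 := hD t z hzt u hut
    have h2 := hG.dist_triangle (u := z) (v := u) (w := r)
    have h3 := hWlow z hz
    have hu : G.dist u r ≤ b := hu
    omega
  obtain ⟨t, ⟨x₃, hx₃, hx₃t⟩, ⟨y₃, hy₃, hy₃t⟩⟩ := subtrees_no_induced_four_cycle D.isTree
    (D.connectedOn_trace hU) (D.connectedOn_trace (connectedOn_support P₂))
    (D.connectedOn_trace (connectedOn_support W)) (D.connectedOn_trace (connectedOn_support Q₂))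
    (D.trace_inter_nonempty (v := x₂) hx₂.le P₂.end_mem_support)
    (D.trace_inter_nonempty (v := x₁) P₂.start_mem_support W.start_mem_support)
    (D.trace_inter_nonempty (v := y₁) W.end_mem_support Q₂.start_mem_support)
    (D.trace_inter_nonempty (v := y₂) Q₂.end_mem_support hy₂.le) hdisj
  have hx₃ : x₃ ∈ P₂.support := hx₃
  have hy₃ : y₃ ∈ Q₂.support := hy₃
  have hxy : G.dist x₃ y₃ ≤ k := hD t x₃ hx₃t y₃ hy₃t
  have hx₃l : G.dist x₃ r ≤ b + k + 1 := by
    rcases (hP₂' x₃ hx₃).2 with rfl | h <;> omega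
  obtain ⟨R, hR⟩ := hG.exists_walk_length_eq_dist x₃ y₃
  refine ⟨(P₁.append (P₂.takeUntil x₃ hx₃)).append
    (R.append ((Q₂.takeUntil y₃ hy₃).reverse.append Q₁.reverse)), ?_, fun z hz => ?_⟩
  · have h1 := P₂.length_takeUntil_le_length hx₃
    have h2 := Q₂.length_takeUntil_le_length hy₃
    simp only [SimpleGraph.Walk.length_append, SimpleGraph.Walk.length_reverse]
    omega
  · simp only [SimpleGraph.Walk.mem_support_append_iff, SimpleGraph.Walk.support_reverse,
      List.mem_reverse] at hz
    rcases hz with (h | h) | h | h | h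
    · exact inK p hp (by omega) z (hP₁' z h).2
    · have := (hP₂' z (P₂.support_takeUntil_subset_support hx₃ h)).2
      refine hK z ?_
      rcases this with rfl | h <;> omega
    · have h1 := dist_add_dist_le_length R h
      have h2 := hG.dist_triangle (u := z) (v := x₃) (w := r)
      have h3 : G.dist z x₃ = G.dist x₃ z := SimpleGraph.dist_comm
      have h4 := hG.dist_triangle (u := z) (v := y₃) (w := r)
      have h5 : G.dist y₃ r ≤ b + k + 1 := by
        rcases (hQ₂' y₃ hy₃).2 with rfl | h <;> omega
      refine hK z ?_
      have h6 := hG.dist_triangle (u := x₃) (v := z) (w := y₃)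
      omega
    · have := (hQ₂' z (Q₂.support_takeUntil_subset_support hy₃ h)).2
      refine hK z ?_
      rcases this with rfl | h <;> omega
    · exact inK w hw hwl z (hQ₁' z h).2

/-! ### The query game -/

/-- `Learn P N 𝒢`: knowing that the hidden graph lies in `𝒢`, at most `N` adaptive distance
queries suffice to reach, whatever the answers, a set of remaining candidates satisfying `P`. -/
def Learn {V : Type u} (P : Set (SimpleGraph V) → Prop) : ℕ → Set (SimpleGraph V) → Prop
  | 0, 𝒢 => P 𝒢
  | N + 1, 𝒢 => P 𝒢 ∨ ∃ u v, ∀ d, Learn P N {G ∈ 𝒢 | G.dist u v = d}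

namespace Learn

variable {V : Type u} {P Q : Set (SimpleGraph V) → Prop} {N M : ℕ} {𝒢 : Set (SimpleGraph V)}

theorem of_done (h : P 𝒢) : Learn P N 𝒢 := by
  cases N with
  | zero => exact h
  | succ N => exact Or.inl h

theorem mono (h : Learn P N 𝒢) (hNM : N ≤ M) : Learn P M 𝒢 := by
  induction N generalizing M 𝒢 with
  | zero => exact of_done h
  | succ N ih =>
    rcases h with h | ⟨u, v, h⟩
    · exact of_done h
    · obtain ⟨M, rfl⟩ : ∃ M', M = M' + 1 := ⟨M - 1, by omega⟩
      exact Or.inr ⟨u, v, fun d => ih (h d) (by omega)⟩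

theorem trans (h : Learn P N 𝒢) (hPQ : ∀ 𝒢', P 𝒢' → Learn Q M 𝒢') : Learn Q (N + M) 𝒢 := by
  induction N generalizing 𝒢 with
  | zero => exact (hPQ 𝒢 h).mono (by omega)
  | succ N ih =>
    rcases h with h | ⟨u, v, h⟩
    · exact (hPQ 𝒢 h).mono (by omega)
    · rw [Nat.succ_add]
      exact Or.inr ⟨u, v, fun d => ih (h d)⟩

theorem imp (h : Learn P N 𝒢) (hPQ : ∀ 𝒢', P 𝒢' → Q 𝒢') : Learn Q N 𝒢 :=
  h.trans (M := 0) hPQ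

/-- Asking a fixed set of queries non-adaptively. -/
theorem queries (𝒢 : Set (SimpleGraph V)) (F : Finset (V × V)) :
    Learn (fun 𝒢' => 𝒢' ⊆ 𝒢 ∧ ∀ q ∈ F, ∀ G ∈ 𝒢', ∀ H ∈ 𝒢', G.dist q.1 q.2 = H.dist q.1 q.2)
      F.card 𝒢 := by
  classical
  induction F using Finset.induction_on generalizing 𝒢 with
  | empty => exact ⟨subset_rfl, by simp⟩
  | @insert q F hq ih =>
    rw [Finset.card_insert_of_notMem hq]
    refine Or.inr ⟨q.1, q.2, fun d => ?_⟩
    refine (ih {G ∈ 𝒢 | G.dist q.1 q.2 = d}).trans (M := 0) fun 𝒢' h => ?_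
    refine ⟨fun G hG => (h.1 hG).1, fun r hr G hG H hH => ?_⟩
    rcases Finset.mem_insert.1 hr with rfl | hr
    · exact (h.1 hG).2.trans (h.1 hH).2.symm
    · exact h.2 r hr G hG H hH

theorem exists_queryTree (h : Learn Set.Subsingleton N 𝒢) :
    ∃ A : QueryTree V, ∀ G ∈ 𝒢, A.result G = G ∧ (A.asked G).length ≤ N := by
  classical
  have base : ∀ (N : ℕ) (𝒢 : Set (SimpleGraph V)), 𝒢.Subsingleton →
      ∃ A : QueryTree V, ∀ G ∈ 𝒢, A.result G = G ∧ (A.asked G).length ≤ N := by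
    intro N 𝒢 h
    rcases 𝒢.eq_empty_or_nonempty with rfl | ⟨G₀, hG₀⟩
    · exact ⟨.output ⊥, by simp⟩
    · exact ⟨.output G₀, fun G hG => ⟨h hG₀ hG, Nat.zero_le _⟩⟩
  induction N generalizing 𝒢 with
  | zero => exact base 0 𝒢 h
  | succ N ih =>
    rcases h with h | ⟨u, v, h⟩
    · exact base _ 𝒢 h
    · choose A hA using fun d => ih (h d)
      refine ⟨.query u v A, fun G hG => ?_⟩
      obtain ⟨h1, h2⟩ := hA (G.dist u v) G ⟨hG, rfl⟩
      exact ⟨h1, by simpa [QueryTree.asked] using h2⟩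

end Learn

theorem QueryTree.result_eq_of_asked {V : Type u} {G H : SimpleGraph V} (A : QueryTree V)
    (h : ∀ q ∈ A.asked G, H.dist q.1 q.2 = G.dist q.1 q.2) : A.result H = A.result G := by
  induction A with
  | output K => rfl
  | query u v next ih =>
    have huv : H.dist u v = G.dist u v := h (u, v) (by simp [QueryTree.asked])
    simp only [QueryTree.result, huv]
    exact ih _ fun q hq => h q (by simp [QueryTree.asked, hq])

/-- Output correctness alone already gives certainty: a graph compatible with all answers is led
to the same leaf. -/
theorem QueryTree.reconstructs_of_result {V : Type u} {A : QueryTree V}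
    {𝒢 : Set (SimpleGraph V)} (h : ∀ G ∈ 𝒢, A.result G = G) : A.Reconstructs 𝒢 :=
  fun G hG => ⟨h G hG, fun H hH hask =>
    (h H hH).symm.trans ((A.result_eq_of_asked hask).trans (h G hG))⟩

theorem RandomisedQueryAlgorithm.expectedQueries_pure {V : Type u} (A : QueryTree V)
    (G : SimpleGraph V) :
    RandomisedQueryAlgorithm.expectedQueries (PMF.pure A) G = ((A.asked G).length : ℝ≥0∞) := by
  classical
  rw [RandomisedQueryAlgorithm.expectedQueries, tsum_eq_single A]
  · simp
  · intro B hB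
    simp [PMF.pure_apply, hB]

theorem exists_algorithm_of_learn {V : Type u} {N : ℕ} {𝒢 : Set (SimpleGraph V)}
    (h : Learn Set.Subsingleton N 𝒢) :
    ∃ A : RandomisedQueryAlgorithm V, RandomisedQueryAlgorithm.Reconstructs A 𝒢 ∧
      ∀ G ∈ 𝒢, RandomisedQueryAlgorithm.expectedQueries A G ≤ (N : ℝ≥0∞) := by
  obtain ⟨A, hA⟩ := h.exists_queryTree
  refine ⟨PMF.pure A, fun D hD => ?_, fun G hG => ?_⟩
  · obtain rfl : D = A := by simpa using hD
    exact QueryTree.reconstructs_of_result fun G hG => (hA G hG).1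
  · rw [RandomisedQueryAlgorithm.expectedQueries_pure]
    exact_mod_cast (hA G hG).2

/-! ### Searching for a parent of a new vertex -/

/-- The vertices other than `v` on the geodesics from `s` to `v`. -/
def geodesicInterval {V : Type*} (G : SimpleGraph V) (s v : V) : Set V :=
  {w | w ≠ v ∧ G.dist s w + G.dist w v = G.dist s v}

theorem exists_walk_in_geodesicInterval {V : Type*} {G : SimpleGraph V} (hG : G.Connected)
    {s v w : V} (hw : w ∈ geodesicInterval G s v) :
    ∃ p : G.Walk s w, ∀ z ∈ p.support, z ∈ geodesicInterval G s v := by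
  obtain ⟨p, hp⟩ := hG.exists_walk_length_eq_dist s w
  refine ⟨p, fun z hz => ?_⟩
  have h1 := dist_add_dist_le_length p hz
  have h2 := hG.dist_triangle (u := z) (v := w) (w := v)
  have h3 := hG.dist_triangle (u := s) (v := z) (w := v)
  have h4 := hw.2
  refine ⟨?_, by omega⟩
  rintro rfl
  have h5 := hG.pos_dist_of_ne hw.1
  have h6 : G.dist s z + G.dist z w ≤ G.dist s w := hp ▸ h1
  omega

/-- The connected component of `s` in `A` contains every interval from `s` contained in `A`, also
for other graphs agreeing on `A`. -/
theorem exists_component {V : Type*} {G₀ : SimpleGraph V} (A : Finset V) (s : V) :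
    ∃ A' : Finset V, A' ⊆ A ∧ ConnectedOn G₀ (A' : Set V) ∧
      ∀ (G : SimpleGraph V) (v : V), G.Connected →
        (∀ u ∈ A, ∀ w ∈ A, G.Adj u w → G₀.Adj u w) →
        geodesicInterval G s v ⊆ A → geodesicInterval G s v ⊆ A' := by
  classical
  refine ⟨A.filter fun x => ∃ p : G₀.Walk s x, ∀ z ∈ p.support, z ∈ A,
    Finset.filter_subset _ _, connectedOn_of_center s ?_, ?_⟩
  · intro x hx
    obtain ⟨-, p, hp⟩ := Finset.mem_filter.1 (Finset.mem_coe.1 hx)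
    refine ⟨p, fun z hz => Finset.mem_coe.2 (Finset.mem_filter.2 ⟨hp z hz, ?_⟩)⟩
    exact ⟨p.takeUntil z hz, fun y hy => hp y (p.support_takeUntil_subset_support hz hy)⟩
  · intro G v hG hagree hA w hw
    obtain ⟨p, hp⟩ := exists_walk_in_geodesicInterval hG hw
    obtain ⟨q, -, hq⟩ := exists_walk_of_agree (K := (A : Set V)) hagree p
      fun z hz => hA (hp z hz)
    exact Finset.mem_coe.2 (Finset.mem_filter.2
      ⟨hA hw, q, fun z hz => hA (hp z (hq ▸ hz))⟩)

/-- The candidates `𝒢` lie in the class, all have the distances `ℓ` to the root `r`, and all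
induce the same graph on `K`. -/
structure KnownOn {V : Type u} [Fintype V] (Δ k : ℕ) (r : V) (ℓ : V → ℕ) (K : Finset V)
    (𝒢 : Set (SimpleGraph V)) : Prop where
  subset : 𝒢 ⊆ boundedTreelengthClass V Δ k
  level : ∀ G ∈ 𝒢, ∀ w, G.dist w r = ℓ w
  agree : ∀ G ∈ 𝒢, ∀ H ∈ 𝒢, ∀ u ∈ K, ∀ w ∈ K, G.Adj u w → H.Adj u w

section

variable {V : Type u} [Fintype V] {Δ k : ℕ} {r : V} {ℓ : V → ℕ} {K : Finset V}
  {𝒢 𝒢' : Set (SimpleGraph V)}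

theorem KnownOn.anti (h : KnownOn Δ k r ℓ K 𝒢) (hs : 𝒢' ⊆ 𝒢) : KnownOn Δ k r ℓ K 𝒢' :=
  ⟨hs.trans h.subset, fun G hG => h.level G (hs hG),
    fun G hG H hH => h.agree G (hs hG) H (hs hH)⟩

theorem KnownOn.connected (h : KnownOn Δ k r ℓ K 𝒢) {G : SimpleGraph V} (hG : G ∈ 𝒢) :
    G.Connected := (h.subset hG).1

open scoped Classical in
theorem KnownOn.maxDegree_le (h : KnownOn Δ k r ℓ K 𝒢) {G : SimpleGraph V} (hG : G ∈ 𝒢) :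
    G.maxDegree ≤ Δ := (h.subset hG).2.1

theorem KnownOn.empty : KnownOn Δ k r ℓ K (∅ : Set (SimpleGraph V)) :=
  ⟨Set.empty_subset _, by simp, by simp⟩

/-- The graphs of the class have balanced separators contained in a ball of radius `k`. -/
theorem exists_balanced_separator {G : SimpleGraph V} (hG : G ∈ boundedTreelengthClass V Δ k)
    (A : Finset V) :
    ∃ S : Finset V, S.card ≤ (Δ + 1) ^ k ∧ ∀ X : Finset V, X ⊆ A → Disjoint X S →
      ConnectedOn G (X : Set V) → 2 * X.card ≤ A.card := by
  classical
  obtain ⟨hconn, hΔ, ι, _, D, hD⟩ := hG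
  obtain ⟨t, ht⟩ := D.exists_balanced_bag A
  refine ⟨Finset.univ.filter (· ∈ D.bag t), ?_, fun X hXA hXS => ht X hXA fun x hx hxt =>
    Finset.disjoint_left.1 hXS hx (by simpa using hxt)⟩
  rcases Finset.eq_empty_or_nonempty (Finset.univ.filter (· ∈ D.bag t)) with h | ⟨x, hx⟩
  · simp [h]
  · obtain ⟨B, hB, hB'⟩ := exists_ball_finset (by convert hΔ) k x
    refine (Finset.card_le_card fun y hy => ?_).trans hB
    obtain ⟨p, hp⟩ := hconn.exists_walk_length_eq_dist x y
    exact hB' y p (hp ▸ hD t x (by simpa using hx) y (by simpa using hy))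

/-- Binary search for a parent of `v`. The search keeps a vertex `s` on a geodesic from `v` to
the root and a set `A` containing the interval from `s` to `v`. The distances from `s` and `v` to
a balanced separator `S` of `A` tell which vertices of `S` lie in the interval. If there are none,
the interval lies in one component of `A \ S`; otherwise the same holds once `s` is replaced by
a child of the interval vertex in `S` closest to `v`. -/
theorem learn_parent (hK : KnownOn Δ k r ℓ K 𝒢) {v : V} (hlow : ∀ w, ℓ w < ℓ v → w ∈ K)
    (m : ℕ) (A : Finset V) (s : V) (hA : A.card < 2 ^ m)
    (hinv : ∀ G ∈ 𝒢, s ≠ v ∧ ℓ s + G.dist s v = ℓ v ∧ geodesicInterval G s v ⊆ A) :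
    Learn (fun 𝒢' => 𝒢' ⊆ 𝒢 ∧ ∃ p, ∀ G ∈ 𝒢', G.Adj p v ∧ ℓ p < ℓ v)
      (m * (2 * (Δ + 1) ^ k + Δ)) 𝒢 := by
  classical
  induction m generalizing 𝒢 A s with
  | zero =>
    refine Learn.of_done ⟨subset_rfl, r, fun G hG => ?_⟩
    obtain ⟨hsv, -, hI⟩ := hinv G hG
    have hs : s ∈ A := hI ⟨hsv, by simp⟩
    simp at hA
    simp [hA] at hs
  | succ m ih =>
    have hfin : ∀ 𝒢', 𝒢' ⊆ 𝒢 → ¬ 𝒢'.Nonempty → ∀ N,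
        Learn (fun 𝒢'' => 𝒢'' ⊆ 𝒢 ∧ ∃ p, ∀ G ∈ 𝒢'', G.Adj p v ∧ ℓ p < ℓ v) N 𝒢' :=
      fun 𝒢' hsub hne N => Learn.of_done ⟨hsub, r, fun G hG => absurd ⟨G, hG⟩ hne⟩
    by_cases hne : 𝒢.Nonempty
    swap
    · exact hfin 𝒢 subset_rfl hne _
    obtain ⟨G₀, hG₀⟩ := hne
    obtain ⟨S, hS, hbal⟩ := exists_balanced_separator (hK.subset hG₀) A
    -- vertices of an interval towards `v` are nearer to the root than `v`, hence known
    have hIK : ∀ G ∈ 𝒢, ∀ x, ℓ x + G.dist x v = ℓ v → geodesicInterval G x v ⊆ K := by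
      intro G hG x hx w hw
      have hc := hK.connected hG
      have h1 := hc.dist_triangle (u := w) (v := x) (w := r)
      have h2 : G.dist w x = G.dist x w := SimpleGraph.dist_comm
      have h3 := hc.pos_dist_of_ne hw.1
      have h4 := hw.2
      rw [hK.level G hG, hK.level G hG] at h1
      exact hlow w (by omega)
    have recurse : ∀ 𝒢₂, 𝒢₂ ⊆ 𝒢 → ∀ x, (∀ G ∈ 𝒢₂, x ≠ v ∧ ℓ x + G.dist x v = ℓ v ∧
        geodesicInterval G x v ⊆ A ∧ ∀ w ∈ S, w ∉ geodesicInterval G x v) →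
        Learn (fun 𝒢'' => 𝒢'' ⊆ 𝒢 ∧ ∃ p, ∀ G ∈ 𝒢'', G.Adj p v ∧ ℓ p < ℓ v)
          (m * (2 * (Δ + 1) ^ k + Δ)) 𝒢₂ := by
      intro 𝒢₂ hsub x hx
      obtain ⟨A', hA', hconn, hmem⟩ := exists_component (G₀ := G₀) ((A ∩ K) \ S) x
      have hcard : 2 * A'.card ≤ A.card := hbal A'
        (hA'.trans (Finset.sdiff_subset.trans Finset.inter_subset_left))
        (Finset.disjoint_left.2 fun y hy => (Finset.mem_sdiff.1 (hA' hy)).2) hconn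
      refine (ih (hK.anti hsub) A' x (by rw [pow_succ] at hA; omega) fun G hG => ?_).imp
        fun 𝒢'' h => ⟨h.1.trans hsub, h.2⟩
      obtain ⟨h1, h2, h3, h4⟩ := hx G hG
      refine ⟨h1, h2, hmem G v (hK.connected (hsub hG)) (fun a ha b hb => ?_) fun w hw => ?_⟩
      · exact hK.agree G (hsub hG) G₀ hG₀ a
          (Finset.mem_inter.1 (Finset.mem_sdiff.1 ha).1).2 b
          (Finset.mem_inter.1 (Finset.mem_sdiff.1 hb).1).2
      · exact Finset.mem_coe.2 (Finset.mem_sdiff.2 ⟨Finset.mem_inter.2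
          ⟨h3 hw, hIK G (hsub hG) x h2 hw⟩, fun h => h4 w h hw⟩)
    have hcost : (m + 1) * (2 * (Δ + 1) ^ k + Δ) =
        2 * (Δ + 1) ^ k + (Δ + m * (2 * (Δ + 1) ^ k + Δ)) := by ring
    rw [hcost]
    refine ((Learn.queries 𝒢 (S.image (fun w => (s, w)) ∪ S.image fun w => (w, v))).mono
      ?_).trans ?_
    · refine (Finset.card_union_le _ _).trans ?_
      have h1 := Finset.card_image_le (s := S) (f := fun w => (s, w))
      have h2 := Finset.card_image_le (s := S) (f := fun w => (w, v))
      omega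
    rintro 𝒢₁ ⟨hsub₁, hq⟩
    by_cases hne₁ : 𝒢₁.Nonempty
    swap
    · exact hfin 𝒢₁ hsub₁ hne₁ _
    obtain ⟨G₁, hG₁⟩ := hne₁
    have hsw : ∀ G ∈ 𝒢₁, ∀ w ∈ S, G.dist s w = G₁.dist s w := fun G hG w hw =>
      hq (s, w) (Finset.mem_union_left _ (Finset.mem_image_of_mem _ hw)) G hG G₁ hG₁
    have hwv : ∀ G ∈ 𝒢₁, ∀ w ∈ S, G.dist w v = G₁.dist w v := fun G hG w hw =>
      hq (w, v) (Finset.mem_union_right _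
        (Finset.mem_image_of_mem (fun w => (w, v)) hw)) G hG G₁ hG₁
    have hsv : ∀ G ∈ 𝒢₁, G.dist s v = G₁.dist s v := fun G hG => by
      have h1 := (hinv G (hsub₁ hG)).2.1
      have h2 := (hinv G₁ (hsub₁ hG₁)).2.1
      omega
    have hI : ∀ G ∈ 𝒢₁, ∀ w ∈ S, w ∈ geodesicInterval G s v ↔ w ∈ geodesicInterval G₁ s v :=
      fun G hG w hw => by
        simp only [geodesicInterval, Set.mem_ofPred_eq, hsw G hG w hw, hwv G hG w hw, hsv G hG]
    rcases Finset.eq_empty_or_nonempty (S.filter (· ∈ geodesicInterval G₁ s v)) with hM | hM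
    · refine (recurse 𝒢₁ hsub₁ s fun G hG => ?_).mono (Nat.le_add_left _ _)
      obtain ⟨h1, h2, h3⟩ := hinv G (hsub₁ hG)
      refine ⟨h1, h2, h3, fun w hw hwI => ?_⟩
      exact Finset.filter_eq_empty_iff.1 hM hw ((hI G hG w hw).1 hwI)
    obtain ⟨c, hc, hmin⟩ := Finset.exists_min_image _ (fun w => G₁.dist w v) hM
    obtain ⟨hcS, hcI⟩ := Finset.mem_filter.1 hc
    -- `c` lies on a geodesic from the root through `s` to `v`
    have hcl : ∀ G ∈ 𝒢₁, ℓ c + G.dist c v = ℓ v := by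
      intro G hG
      have hconn := hK.connected (hsub₁ hG)
      have h1 := hconn.dist_triangle (u := c) (v := s) (w := r)
      have h2 : G.dist c s = G.dist s c := SimpleGraph.dist_comm
      have h3 := hconn.dist_triangle (u := v) (v := c) (w := r)
      have h4 : G.dist v c = G.dist c v := SimpleGraph.dist_comm
      have h5 := ((hI G hG c hcS).2 hcI).2
      have h6 := (hinv G (hsub₁ hG)).2.1
      rw [hK.level G (hsub₁ hG), hK.level G (hsub₁ hG)] at h1 h3
      omega
    by_cases hc1 : G₁.dist c v = 1
    · refine Learn.of_done ⟨hsub₁, c, fun G hG => ?_⟩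
      have h1 : G.dist c v = 1 := (hwv G hG c hcS).trans hc1
      have h2 := hcl G hG
      exact ⟨SimpleGraph.dist_eq_one_iff_adj.1 h1, by omega⟩
    refine ((Learn.queries 𝒢₁ ((G₀.neighborFinset c).image fun x => (x, v))).mono
      (Finset.card_image_le.trans ?_)).trans ?_
    · rw [SimpleGraph.card_neighborFinset_eq_degree]
      refine (G₀.degree_le_maxDegree c).trans ?_
      convert hK.maxDegree_le hG₀
    rintro 𝒢₂ ⟨hsub₂, hq₂⟩
    have hsub : 𝒢₂ ⊆ 𝒢 := hsub₂.trans hsub₁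
    by_cases hne₂ : 𝒢₂.Nonempty
    swap
    · exact hfin 𝒢₂ hsub hne₂ _
    obtain ⟨G₂, hG₂⟩ := hne₂
    have hpos : ∀ G ∈ 𝒢, ∀ x, x ≠ v → 0 < G.dist x v := fun G hG x hx =>
      (hK.connected hG).pos_dist_of_ne hx
    have hcK : c ∈ K := by
      have h1 := hcl G₁ hG₁
      have h2 := hpos G₁ (hsub₁ hG₁) c hcI.1
      exact hlow c (by omega)
    obtain ⟨x, hcx, hx⟩ := exists_adj_closer (hK.connected (hsub hG₂)) hcI.1
    have hxv : x ≠ v := by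
      rintro rfl
      have h1 := hwv G₂ (hsub₂ hG₂) c hcS
      rw [SimpleGraph.dist_self] at hx
      omega
    have hxK : x ∈ K := by
      have hconn := hK.connected (hsub hG₂)
      have h1 := hconn.dist_triangle (u := x) (v := c) (w := r)
      have h2 := SimpleGraph.dist_eq_one_iff_adj.2 hcx.symm
      have h3 := hcl G₂ (hsub₂ hG₂)
      have h4 := hpos G₂ (hsub hG₂) x hxv
      rw [hK.level G₂ (hsub hG₂), hK.level G₂ (hsub hG₂)] at h1
      exact hlow x (by omega)
    refine recurse 𝒢₂ hsub x fun G hG => ?_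
    have hconn := hK.connected (hsub hG)
    have hadj : G.Adj c x := hK.agree G₂ (hsub hG₂) G (hsub hG) c hcK x hxK hcx
    have hadj₀ : G₀.Adj c x := hK.agree G₂ (hsub hG₂) G₀ hG₀ c hcK x hxK hcx
    have hxd : G.dist x v + 1 = G.dist c v := by
      have h1 : G.dist x v = G₂.dist x v := hq₂ (x, v)
        (Finset.mem_image_of_mem (fun x => (x, v)) (by simpa using hadj₀)) G hG G₂ hG₂
      rw [h1, hx, hwv G (hsub₂ hG) c hcS, hwv G₂ (hsub₂ hG₂) c hcS]
    have hcx1 : G.dist c x = 1 := SimpleGraph.dist_eq_one_iff_adj.2 hadj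
    have hcs := ((hI G (hsub₂ hG) c hcS).2 hcI).2
    have hxI : ∀ w ∈ geodesicInterval G x v, w ∈ geodesicInterval G s v := by
      intro w hw
      have h1 := hw.2
      have h2 := hconn.dist_triangle (u := s) (v := c) (w := w)
      have h3 := hconn.dist_triangle (u := c) (v := x) (w := w)
      have h4 := hconn.dist_triangle (u := s) (v := w) (w := v)
      exact ⟨hw.1, by omega⟩
    refine ⟨hxv, ?_, fun w hw => (hinv G (hsub hG)).2.2 (hxI w hw), fun w hwS hw => ?_⟩
    · have h1 := hcl G (hsub₂ hG)
      have h2 := hconn.dist_triangle (u := x) (v := c) (w := r)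
      have h3 := hconn.dist_triangle (u := v) (v := x) (w := r)
      have h4 : G.dist x c = G.dist c x := SimpleGraph.dist_comm
      have h5 : G.dist v x = G.dist x v := SimpleGraph.dist_comm
      rw [hK.level G (hsub hG), hK.level G (hsub hG)] at h2 h3
      omega
    · have h1 := hmin w (Finset.mem_filter.2 ⟨hwS, (hI G (hsub₂ hG) w hwS).1 (hxI w hw)⟩)
      have h2 := hwv G (hsub₂ hG) w hwS
      have h3 := hwv G (hsub₂ hG) c hcS
      have h4 := hw.2
      omega

/-! ### Inserting the vertices in order of distance to the root -/

/-- Once a parent `p` of `v` is known, all neighbours of `v` in `K` are within bounded distance of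
`p` inside `K`, so they are found by querying `v` against a ball of a reference candidate. -/
theorem learn_insert [DecidableEq V] (hK : KnownOn Δ k r ℓ K 𝒢) {v : V} (hr : r ∈ K)
    (hv : v ∉ K) (hlow : ∀ w, ℓ w < ℓ v → w ∈ K) (hhigh : ∀ w ∈ K, ℓ w ≤ ℓ v) {m : ℕ}
    (hm : Fintype.card V < 2 ^ m) :
    Learn (KnownOn Δ k r ℓ (insert v K))
      (m * (2 * (Δ + 1) ^ k + Δ) + (Δ + 1) ^ (5 * k + 4)) 𝒢 := by
  refine (learn_parent hK hlow m Finset.univ r (by simpa using hm) fun G hG => ⟨?_, ?_, ?_⟩).trans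
    ?_
  · rintro rfl; exact hv hr
  · rw [← hK.level G hG, ← hK.level G hG, SimpleGraph.dist_self, SimpleGraph.dist_comm, zero_add]
  · simp
  rintro 𝒢₁ ⟨hsub₁, p, hp⟩
  by_cases hne : 𝒢₁.Nonempty
  swap
  · rw [Set.not_nonempty_iff_eq_empty.1 hne]
    exact Learn.of_done KnownOn.empty
  obtain ⟨G₀, hG₀⟩ := hne
  obtain ⟨B, hB, hB'⟩ := exists_ball_finset (hK.maxDegree_le (hsub₁ hG₀)) (5 * k + 4) p
  refine ((Learn.queries 𝒢₁ (B.image fun w => (w, v))).mono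
    (Finset.card_image_le.trans hB)).imp ?_
  rintro 𝒢₂ ⟨hsub₂, hq⟩
  have hsub : 𝒢₂ ⊆ 𝒢 := hsub₂.trans hsub₁
  have key : ∀ G ∈ 𝒢₂, ∀ H ∈ 𝒢₂, ∀ w ∈ K, G.Adj w v → H.Adj w v := by
    intro G hG H hH w hw hwv
    have hlev := hK.level G (hsub hG)
    obtain ⟨hpv, hpl⟩ := hp G (hsub₂ hG)
    have hl : G.dist p r + 1 = G.dist v r := by
      have h1 := (hK.connected (hsub hG)).dist_triangle (u := v) (v := p) (w := r)
      have h2 := SimpleGraph.dist_eq_one_iff_adj.2 hpv.symm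
      rw [hlev, hlev] at h1 ⊢
      omega
    obtain ⟨q, hql, hqK⟩ := exists_short_walk_in_known (K := (K : Set V))
      (hK.connected (hsub hG)) (hK.subset (hsub hG)).2.2
      (fun x hx => hlow x (by rwa [hlev, hlev] at hx)) (hlow p hpl) hw hpv hwv hl
      (by rw [hlev, hlev]; exact hhigh w hw)
    obtain ⟨q', hq', -⟩ := exists_walk_of_agree
      (fun a ha b hb => hK.agree G (hsub hG) G₀ (hsub₁ hG₀) a ha b hb) q hqK
    have hwB : w ∈ B := hB' w q' (hq' ▸ hql)
    have h := hq (w, v) (Finset.mem_image_of_mem (fun w => (w, v)) hwB) G hG H hH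
    rw [← SimpleGraph.dist_eq_one_iff_adj] at hwv ⊢
    exact h.symm.trans hwv
  refine ⟨(hK.anti hsub).subset, (hK.anti hsub).level, fun G hG H hH a ha b hb hab => ?_⟩
  rcases Finset.mem_insert.1 ha with rfl | haK <;> rcases Finset.mem_insert.1 hb with rfl | hbK
  · exact absurd rfl hab.ne
  · exact (key G hG H hH b hbK hab.symm).symm
  · exact key G hG H hH a haK hab
  · exact hK.agree G (hsub hG) H (hsub hH) a haK b hbK hab

theorem learn_of_knownOn {m : ℕ} (hm : Fintype.card V < 2 ^ m) (j : ℕ)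
    (hK : KnownOn Δ k r ℓ K 𝒢) (hr : r ∈ K) (hdown : ∀ u ∈ K, ∀ w, ℓ w < ℓ u → w ∈ K)
    (hj : K.card + j = Fintype.card V) :
    Learn Set.Subsingleton
      (j * (m * (2 * (Δ + 1) ^ k + Δ) + (Δ + 1) ^ (5 * k + 4))) 𝒢 := by
  classical
  induction j generalizing K 𝒢 with
  | zero =>
    obtain rfl : K = Finset.univ := (Finset.card_eq_iff_eq_univ K).1 hj
    refine Learn.of_done fun G hG H hH => ?_
    ext a b
    exact ⟨hK.agree G hG H hH a (Finset.mem_univ _) b (Finset.mem_univ _),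
      hK.agree H hH G hG a (Finset.mem_univ _) b (Finset.mem_univ _)⟩
  | succ j ih =>
    have hne : Kᶜ.Nonempty := by
      rw [← Finset.card_pos, Finset.card_compl]
      omega
    obtain ⟨v, hv, hmin⟩ := Finset.exists_min_image Kᶜ ℓ hne
    rw [Finset.mem_compl] at hv
    have hlow : ∀ w, ℓ w < ℓ v → w ∈ K := fun w hw => by
      by_contra h
      exact absurd (hmin w (Finset.mem_compl.2 h)) (not_le.2 hw)
    have hhigh : ∀ w ∈ K, ℓ w ≤ ℓ v := fun w hw => by
      by_contra! h
      exact hv (hdown w hw v h)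
    rw [Nat.succ_mul, Nat.add_comm]
    refine (learn_insert hK hr hv hlow hhigh hm).trans fun 𝒢' h𝒢' =>
      ih h𝒢' (Finset.mem_insert_of_mem hr) ?_ ?_
    · intro u hu w hw
      rcases Finset.mem_insert.1 hu with rfl | hu
      · exact Finset.mem_insert_of_mem (hlow w hw)
      · exact Finset.mem_insert_of_mem (hdown u hu w hw)
    · rw [Finset.card_insert_of_notMem hv]
      omega

theorem learn_boundedTreelengthClass [Nonempty V] (Δ k : ℕ) {m : ℕ}
    (hm : Fintype.card V < 2 ^ m) :
    Learn Set.Subsingleton (Fintype.card V +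
      Fintype.card V * (m * (2 * (Δ + 1) ^ k + Δ) + (Δ + 1) ^ (5 * k + 4)))
      (boundedTreelengthClass V Δ k) := by
  classical
  obtain ⟨r⟩ := ‹Nonempty V›
  refine ((Learn.queries (boundedTreelengthClass V Δ k)
    (Finset.univ.image fun w => (w, r))).mono Finset.card_image_le).trans ?_
  rintro 𝒢 ⟨hsub, hq⟩
  rcases 𝒢.eq_empty_or_nonempty with rfl | ⟨G₀, hG₀⟩
  · exact Learn.of_done Set.subsingleton_empty
  have hcard : 0 < Fintype.card V := Fintype.card_pos_iff.2 ⟨r⟩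
  refine (learn_of_knownOn (r := r) (ℓ := fun w => G₀.dist w r) (K := {r}) hm
    (Fintype.card V - 1) ⟨hsub, fun G hG w => ?_, ?_⟩ (Finset.mem_singleton_self r) ?_ ?_).mono
    (Nat.mul_le_mul_right _ (Nat.sub_le _ _))
  · exact hq (w, r) (Finset.mem_image_of_mem (fun w => (w, r)) (Finset.mem_univ w)) G hG G₀ hG₀
  · intro G _ H _ u hu w hw h
    rw [Finset.mem_singleton.1 hu, Finset.mem_singleton.1 hw] at h
    exact absurd rfl h.ne
  · intro u hu w hw
    rw [Finset.mem_singleton.1 hu] at hw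
    simp at hw
  · rw [Finset.card_singleton]
    omega

end

/-! ### Parameters -/

theorem subsingleton_boundedTreelengthClass_or {V : Type u} [Fintype V] (Δ k : ℕ) :
    (boundedTreelengthClass V Δ k).Subsingleton ∨ (3 ≤ Fintype.card V ∧ 2 ≤ Δ ∧ 1 ≤ k) := by
  classical
  by_cases hn : Fintype.card V ≤ 2
  · -- a connected graph on at most two vertices is complete
    left
    have htop : ∀ G ∈ boundedTreelengthClass V Δ k, G = ⊤ := by
      intro G hG
      ext a b
      refine ⟨fun h => h.ne, fun hab => ?_⟩
      obtain ⟨y, hy, -⟩ := exists_adj_closer hG.1 (show a ≠ b from hab)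
      rcases eq_or_ne y b with rfl | hyb
      · exact hy
      · have h3 : ({a, b, y} : Finset V).card = 3 :=
          Finset.card_eq_three.2 ⟨a, b, y, hab, hy.ne, hyb.symm, rfl⟩
        have := Finset.card_le_univ ({a, b, y} : Finset V)
        omega
    exact fun G hG H hH => (htop G hG).trans (htop H hH).symm
  rcases (boundedTreelengthClass V Δ k).eq_empty_or_nonempty with h | ⟨G, hconn, hΔ, hk⟩
  · exact Or.inl (h ▸ Set.subsingleton_empty)
  refine Or.inr ⟨by omega, ?_, ?_⟩
  · -- a connected graph has at least `n - 1` edges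
    have h1 := hconn.card_vert_le_card_edgeSet_add_one
    have h2 := G.sum_degrees_eq_twice_card_edges
    have h3 : ∑ v, G.degree v ≤ Fintype.card V * Δ := by
      refine (Finset.sum_le_card_nsmul Finset.univ _ Δ fun v _ =>
        (G.degree_le_maxDegree v).trans (by convert hΔ)).trans ?_
      simp
    rw [Nat.card_eq_fintype_card, Nat.card_eq_fintype_card, ← SimpleGraph.edgeFinset_card] at h1
    by_contra! hlt
    have h4 : Fintype.card V * Δ ≤ Fintype.card V * 1 := Nat.mul_le_mul_left _ (by omega)
    omega
  · obtain ⟨a, b, hab⟩ := Fintype.exists_pair_of_one_lt_card (α := V) (by omega)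
    obtain ⟨y, hy, -⟩ := exists_adj_closer hconn hab
    obtain ⟨ι, _, D, hD⟩ := hk
    obtain ⟨t, hat, hyt⟩ := D.exists_bag_of_adj a y hy
    have := hD t a hat y hyt
    rwa [SimpleGraph.dist_eq_one_iff_adj.2 hy] at this

theorem query_count_le {Δ k n : ℕ} (hn : 3 ≤ n) (hΔ : 2 ≤ Δ) (hk : 1 ≤ k) :
    n + n * ((Nat.log 2 n + 1) * (2 * (Δ + 1) ^ k + Δ) + (Δ + 1) ^ (5 * k + 4)) ≤
      Δ ^ (20 * k) * n * Nat.log 2 n ^ 2 := by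
  have hL : 1 ≤ Nat.log 2 n := Nat.log_pos (by norm_num) (by omega)
  generalize Nat.log 2 n = L at hL ⊢
  have hΔ1 : Δ + 1 ≤ Δ ^ 2 := by nlinarith
  have hD : 2 ≤ Δ ^ k := hΔ.trans (Nat.le_self_pow (by omega) Δ)
  have h1 : (Δ + 1) ^ k ≤ (Δ ^ k) ^ 2 := by
    calc (Δ + 1) ^ k ≤ (Δ ^ 2) ^ k := Nat.pow_le_pow_left hΔ1 k
      _ = (Δ ^ k) ^ 2 := by rw [← pow_mul, ← pow_mul, mul_comm]
  have h2 : Δ ≤ Δ ^ k := Nat.le_self_pow (by omega) Δ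
  have h3 : (Δ + 1) ^ (5 * k + 4) ≤ (Δ ^ k) ^ 18 := by
    calc (Δ + 1) ^ (5 * k + 4) ≤ (Δ + 1) ^ (9 * k) :=
          Nat.pow_le_pow_right (by omega) (by omega)
      _ ≤ (Δ ^ 2) ^ (9 * k) := Nat.pow_le_pow_left hΔ1 _
      _ = (Δ ^ k) ^ 18 := by rw [← pow_mul, ← pow_mul]; congr 1; ring
  have h4 : Δ ^ (20 * k) = (Δ ^ k) ^ 20 := by rw [← pow_mul, mul_comm]
  rw [h4]
  generalize Δ ^ k = D at *
  have hL2 : L + 1 ≤ 2 * L ^ 2 := by nlinarith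
  have hD2 : 4 * D ^ 18 ≤ D ^ 20 := by
    rw [show D ^ 20 = D ^ 2 * D ^ 18 by ring]
    exact Nat.mul_le_mul_right _ (by nlinarith)
  have hD3 : 1 + 4 * D ^ 2 + 2 * D ≤ 3 * D ^ 18 := by
    have h5 : D ^ 2 * 2 ^ 16 ≤ D ^ 18 := by
      rw [show D ^ 18 = D ^ 2 * D ^ 16 by ring]
      exact Nat.mul_le_mul_left _ (Nat.pow_le_pow_left hD 16)
    nlinarith
  have hL1 : 1 ≤ L ^ 2 := Nat.one_le_pow _ _ hL
  have h6 : (L + 1) * (2 * (Δ + 1) ^ k + Δ) ≤ L ^ 2 * (4 * D ^ 2 + 2 * D) := by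
    calc (L + 1) * (2 * (Δ + 1) ^ k + Δ) ≤ (2 * L ^ 2) * (2 * D ^ 2 + D) :=
          Nat.mul_le_mul hL2 (by omega)
      _ = L ^ 2 * (4 * D ^ 2 + 2 * D) := by ring
  calc n + n * ((L + 1) * (2 * (Δ + 1) ^ k + Δ) + (Δ + 1) ^ (5 * k + 4))
      = n * (1 + ((L + 1) * (2 * (Δ + 1) ^ k + Δ) + (Δ + 1) ^ (5 * k + 4))) := by ring
    _ ≤ n * (L ^ 2 * D ^ 20) := by
        refine Nat.mul_le_mul_left n ?_
        have h7 : L ^ 2 * (1 + 4 * D ^ 2 + 2 * D) ≤ L ^ 2 * (3 * D ^ 18) :=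
          Nat.mul_le_mul_left _ hD3
        have h8 : 1 * D ^ 18 ≤ L ^ 2 * D ^ 18 := Nat.mul_le_mul_right _ hL1
        have h9 : L ^ 2 * (4 * D ^ 18) ≤ L ^ 2 * D ^ 20 := Nat.mul_le_mul_left _ hD2
        linarith
    _ = D ^ 20 * n * L ^ 2 := by ring

theorem theorem1 :
    ∃ c : ℕ, ∀ (Δ k : ℕ) (V : Type u) [Fintype V],
      ∃ A : RandomisedQueryAlgorithm V,
        RandomisedQueryAlgorithm.Reconstructs A (boundedTreelengthClass V Δ k) ∧
        ∀ G ∈ boundedTreelengthClass V Δ k,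
          RandomisedQueryAlgorithm.expectedQueries A G ≤
            ENNReal.ofReal ((Δ : ℝ) ^ (c * k) * (Fintype.card V : ℝ) *
              (Real.logb 2 (Fintype.card V : ℝ)) ^ 2) := by
  refine ⟨20, fun Δ k V _ => ?_⟩
  rcases subsingleton_boundedTreelengthClass_or (V := V) Δ k with h | ⟨hn, hΔ, hk⟩
  · obtain ⟨A, hA, hcost⟩ := exists_algorithm_of_learn (Learn.of_done (N := 0) h)
    exact ⟨A, hA, fun G hG => (hcost G hG).trans (by simp)⟩
  · have : Nonempty V := Fintype.card_pos_iff.1 (by omega)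
    obtain ⟨A, hA, hcost⟩ := exists_algorithm_of_learn
      (learn_boundedTreelengthClass (V := V) Δ k (Nat.lt_pow_succ_log_self one_lt_two _))
    refine ⟨A, hA, fun G hG => (hcost G hG).trans ?_⟩
    rw [← ENNReal.ofReal_natCast]
    refine ENNReal.ofReal_le_ofReal ?_
    have h1 : (Nat.log 2 (Fintype.card V) : ℝ) ≤ Real.logb 2 (Fintype.card V) := by
      exact_mod_cast Real.natLog_le_logb (Fintype.card V) 2
    refine (Nat.cast_le.2 (query_count_le hn hΔ hk)).trans ?_
    push_cast
    gcongr
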